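/- Let $(\mathcal X,\mathrm dx)$ be a measure space and let $W_t:\mathcal X\to\mathbb R$, $t\in[0,1]$, be such that, with $Z_t=\int_{\mathcal X}e^{W_t(x)}\,\mathrm dx$, the functions $\pi_t(x)=Z_t^{-1}e^{W_t(x)}$ are probability densities on $\mathcal X$ and $t\mapsto\pi_t(x)$ is continuous on $[0,1]$ for every $x\in\mathcal X$ (an annealing path). For $t,t'\in[0,1]$ put $$A_{t,t'}(x,x')=(W_{t'}(x)-W_t(x))-(W_{t'}(x')-W_t(x')),$$ $$r(t,t')=1-\mathbb E\big[\exp(\min\{0,A_{t,t'}(X,X')\})\big],\qquad X\sim\pi_t,\ X'\sim\pi_{t'}\ \text{independent},$$ $$\Lambda(t,t')=\frac12\int_0^1\mathbb E\big[|A_{t,t'}(X_s,X'_s)|\big]\,\mathrm ds,\qquad X_s,X_s'\overset{\text{i.i.d.}}{\sim}\frac{1}{Z_s(t,t')}\exp\big((1-s)W_t+sW_{t'}\big),$$ where $Z_s(t,t')=\int_{\mathcal X}\exp\big((1-s)W_t(x)+sW_{t'}(x)\big)\,\mathrm dx$. Suppose that for every $x\in\mathcal X$ the function $t\mapsto W_t(x)$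 is piecewise continuously differentiable on $[0,1]$ (for some finite partition of $[0,1]$, possibly depending on $x$, it agrees on each open piece with a $C^1$ function on the closed piece), and that there is a measurable $V_1:\mathcal X\to[0,\infty)$ such that $$\sup_{t}\Big|\frac{\mathrm dW_t}{\mathrm dt}(x)\Big|\le V_1(x)\quad\text{for all }x\in\mathcal X,\qquad \sup_{t\in[0,1]}\mathbb E_{\pi_t}[V_1^3]<\infty,$$ where the first supremum is over all $t\in[0,1]$ at which the derivative exists (one-sided at $t=0,1$). Then the secant distributions and $\Lambda(t,t')$ are well defined (all normalizing constants, expectations and integrals in its definition are finite), and there is a constant $C<\infty$, independent of $t,t'$, such that for all $t,t'\in[0,1]$ $$|r(t,t')-\Lambda(t,t')|\le C\,|t-t'|^3.$$ -/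

import Mathlib

open MeasureTheory Set
open scoped ENNReal NNReal

noncomputable section

/-- The function `x ↦ exp (w x) / ∫ exp w dμ`, i.e. the density with respect to the base measure
`μ` (written `dx` in the literature) that has log-density `w` up to an additive constant.
The measure with this density is Mathlib's `μ.tilted w`. -/
def normalizedDensity {X : Type*} [MeasurableSpace X] (μ : Measure X) (w : X → ℝ) (x : X) : ℝ :=
  Real.exp (w x) / ∫ y, Real.exp (w y) ∂μ

/-- `p` is a probability density with full support on `X` with respect to `μ`. -/
structure IsFullDensity {X : Type*} [MeasurableSpace X] (μ : Measure X) (p : X → ℝ) : Prop where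
  measurable : Measurable p
  pos : ∀ x, 0 < p x
  lintegral_eq_one : ∫⁻ x, ENNReal.ofReal (p x) ∂μ = 1

/-- An annealing path: a family of full-support probability densities `p t`, `t ∈ [0, 1]`, such
that `t ↦ p t x` is continuous on `[0, 1]` for each point `x`. -/
structure IsAnnealingPath {X : Type*} [MeasurableSpace X] (μ : Measure X) (p : ℝ → X → ℝ) :
    Prop where
  density : ∀ t ∈ Icc (0 : ℝ) 1, IsFullDensity μ (p t)
  continuousOn : ∀ x, ContinuousOn (fun t => p t x) (Icc 0 1)

/-- `f` is piecewise continuously differentiable on `[0, 1]`: there is a finite partition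
`0 = a 0 < a 1 < ⋯ < a n = 1` such that on each open piece `f` agrees with a function that is `C¹`
on the closed piece.  Jumps of `f` and of its derivative at partition points are allowed. -/
def PiecewiseC1 (f : ℝ → ℝ) : Prop :=
  ∃ (n : ℕ) (a : Fin (n + 1) → ℝ), StrictMono a ∧ a 0 = 0 ∧ a (Fin.last n) = 1 ∧
    ∀ i : Fin n, ∃ g : ℝ → ℝ,
      ContDiffOn ℝ 1 g (Icc (a i.castSucc) (a i.succ)) ∧
      EqOn f g (Ioo (a i.castSucc) (a i.succ))

/-- The log acceptance ratio
`A_{t,t'}(x, x') = (W_{t'}(x) - W_t(x)) - (W_{t'}(x') - W_t(x'))`. -/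
def logAcceptance {X : Type*} (W : ℝ → X → ℝ) (t t' : ℝ) (x x' : X) : ℝ :=
  (W t' x - W t x) - (W t' x' - W t x')

/-- The swap rejection rate `r(t, t') = 1 - E[exp (min {0, A_{t,t'}(X, X')})]`, with independent
`X ∼ π_t` and `X' ∼ π_{t'}`. -/
def rejectionRate {X : Type*} [MeasurableSpace X] (μ : Measure X) (W : ℝ → X → ℝ) (t t' : ℝ) : ℝ :=
  1 - ∫ z, Real.exp (min 0 (logAcceptance W t t' z.1 z.2))
    ∂((μ.tilted (W t)).prod (μ.tilted (W t')))

/-- The unnormalized log-density `(1 - s) W_t + s W_{t'}` on the linear secant from `t` to `t'`. -/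
def secant {X : Type*} (W : ℝ → X → ℝ) (t t' s : ℝ) (x : X) : ℝ :=
  (1 - s) * W t x + s * W t' x

/-- The law of an i.i.d. pair `(X_s, X'_s)` from the secant distribution at parameter `s`. -/
def secantPair {X : Type*} [MeasurableSpace X] (μ : Measure X) (W : ℝ → X → ℝ) (t t' s : ℝ) :
    Measure (X × X) :=
  (μ.tilted (secant W t t' s)).prod (μ.tilted (secant W t t' s))

/-- The communication barrier of the linear secant,
`Λ(t, t') = (1/2) ∫_0^1 E[|A_{t,t'}(X_s, X'_s)|] ds`. -/
def secantBarrier {X : Type*} [MeasurableSpace X] (μ : Measure X) (W : ℝ → X → ℝ) (t t' : ℝ) : ℝ :=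
  (1 / 2) * ∫ s in (0 : ℝ)..1, ∫ z, |logAcceptance W t t' z.1 z.2| ∂(secantPair μ W t t' s)

end

/-! ### Elementary inequalities for the exponential -/

/-! Take `ν = π_t` as reference law and let `D = W_{t'} - W_t + c` be the log-density of `π_{t'}`
with respect to `ν`, with `δ = |t - t'|`. With independent arguments `x, x'` of law `ν`, and `a = D
x`, `b = D x'`, the rejection rate is half the integral of `|e^a - e^b|` (`rejection_eq`). The
barrier is half the integral over `s` of `G s / Z s ^ 2`, where `G s` integrates `|a - b|
e^{s(a+b)}` and `Z s = ∫ e^{sD} dν` (`integral_abs_sub_tilted`).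

Both are compared with the trapezoid value `(G 0 + G 1) / 2`. Each replacement costs third order in
`|a| + |b|`, because a factor `|a - b|` multiplies a second-order error. The normalization also
costs third order: `Z 0 = Z 1 = 1` and convexity give `0 ≤ 1 - Z s = O(δ²)`, while `G = O(δ)`. This
is `abs_integral_abs_exp_sub_sub_le`.

All errors carry weights of the form `1 + e^D`, which turn `ν` into `π_t + π_{t'}`; hence third
moments under the path suffice and no exponential moments are needed.

It remains to bound `|D|` by `δ V` with uniform third moments (`exists_isDominatedLogDensity`).
Individual `W_t(x)` may jump in `t`, but `W_t(x) - W_t(x₀)` is continuous because the normalizing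
constant cancels, so the derivative bound makes it Lipschitz. Jensen's inequality under `π_t` and
`π_{t'}` then controls the remaining constant. -/

lemma exp_sub_one_le_mul_exp (x : ℝ) : Real.exp x - 1 ≤ x * Real.exp x := by
  have h := mul_le_mul_of_nonneg_right (Real.add_one_le_exp (-x)) (Real.exp_pos x).le
  rw [← Real.exp_add, neg_add_cancel, Real.exp_zero] at h
  linarith

lemma abs_exp_sub_one_le_mul (x : ℝ) : |Real.exp x - 1| ≤ |x| * (1 + Real.exp x) := by
  have h1 := exp_sub_one_le_mul_exp x
  have h2 := Real.add_one_le_exp x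
  have h3 := Real.exp_pos x
  have h4 := mul_le_mul_of_nonneg_right (le_abs_self x) h3.le
  have h5 := neg_abs_le x
  have h6 := mul_nonneg (abs_nonneg x) h3.le
  rw [abs_le]
  constructor <;> nlinarith [abs_nonneg x]

lemma exp_sub_one_sub_self_le (x : ℝ) : Real.exp x - 1 - x ≤ x ^ 2 * (1 + Real.exp x) := by
  have h1 := exp_sub_one_le_mul_exp x
  have h2 : x * (Real.exp x - 1) ≤ |x| * |Real.exp x - 1| := by
    rw [← abs_mul]; exact le_abs_self _
  have h3 := mul_le_mul_of_nonneg_left (abs_exp_sub_one_le_mul x) (abs_nonneg x)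
  have h4 : |x| * (|x| * (1 + Real.exp x)) = x ^ 2 * (1 + Real.exp x) := by
    rw [← sq_abs x]; ring
  linarith

lemma exp_mul_le_chord (x : ℝ) {s : ℝ} (hs : s ∈ Icc (0 : ℝ) 1) :
    Real.exp (s * x) ≤ (1 - s) + s * Real.exp x := by
  have h := convexOn_exp.2 (mem_univ 0) (mem_univ x) (sub_nonneg.2 hs.2) hs.1 (by ring)
  simpa using h

lemma chord_sub_exp_mul_le (x : ℝ) {s : ℝ} (hs : s ∈ Icc (0 : ℝ) 1) :
    (1 - s) + s * Real.exp x - Real.exp (s * x) ≤ x ^ 2 * (1 + Real.exp x) := by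
  have h1 := Real.add_one_le_exp (s * x)
  have h2 := exp_sub_one_sub_self_le x
  have h3 : 0 ≤ Real.exp x - 1 - x := by linarith [Real.add_one_le_exp x]
  have h4 : s * (Real.exp x - 1 - x) ≤ 1 * (Real.exp x - 1 - x) :=
    mul_le_mul_of_nonneg_right hs.2 h3
  linarith

lemma abs_exp_mul_sub_chord_le (x : ℝ) {s : ℝ} (hs : s ∈ Icc (0 : ℝ) 1) :
    |Real.exp (s * x) - ((1 - s) + s * Real.exp x)| ≤ x ^ 2 * (1 + Real.exp x) := by
  rw [abs_sub_comm, abs_of_nonneg (by linarith [exp_mul_le_chord x hs])]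
  exact chord_sub_exp_mul_le x hs

lemma exp_mul_le_one_add_exp (x : ℝ) {s : ℝ} (hs : s ∈ Icc (0 : ℝ) 1) :
    Real.exp (s * x) ≤ 1 + Real.exp x := by
  have h1 := exp_mul_le_chord x hs
  have h2 := mul_le_mul_of_nonneg_right hs.2 (Real.exp_pos x).le
  linarith [hs.1]

/-- Integrating `x e^{sx}` over `[0, 1]` gives `e^x - 1`, and integrating its chord gives the
trapezoid term. The pointwise chord error is quadratic, and the prefactor `x` supplies the third
order. -/
lemma abs_exp_sub_one_sub_trapezoid_le (x : ℝ) :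
    |Real.exp x - 1 - x * (1 + Real.exp x) / 2| ≤ |x| ^ 3 * (1 + Real.exp x) := by
  have hcont : Continuous fun s : ℝ => x * Real.exp (s * x) := by fun_prop
  have h1 : ∫ s in (0 : ℝ)..1, x * Real.exp (s * x) = Real.exp x - 1 := by
    rw [intervalIntegral.integral_eq_sub_of_hasDerivAt (f := fun s => Real.exp (s * x))
      _ (hcont.intervalIntegrable _ _)]
    · simp
    · intro s _
      simpa [mul_comm] using ((hasDerivAt_id s).mul_const x).exp
  have hcont2 : Continuous fun s : ℝ => x * ((1 - s) + s * Real.exp x) := by fun_prop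
  have h2 : ∫ s in (0 : ℝ)..1, x * ((1 - s) + s * Real.exp x) = x * (1 + Real.exp x) / 2 := by
    rw [intervalIntegral.integral_eq_sub_of_hasDerivAt
      (f := fun s => x * ((s - s ^ 2 / 2) + s ^ 2 / 2 * Real.exp x))
      _ (hcont2.intervalIntegrable _ _)]
    · norm_num; ring
    · intro s _
      have hsq : HasDerivAt (fun s : ℝ => s ^ 2 / 2) s s := by
        have := (hasDerivAt_pow 2 s).div_const 2
        simpa using this
      exact (((hasDerivAt_id s).sub hsq).add (hsq.mul_const _)).const_mul x
  rw [← h1, ← h2, ← intervalIntegral.integral_sub (hcont.intervalIntegrable _ _)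
    (hcont2.intervalIntegrable _ _)]
  have := intervalIntegral.norm_integral_le_of_norm_le_const (a := 0) (b := 1)
    (f := fun s : ℝ => x * Real.exp (s * x) - x * ((1 - s) + s * Real.exp x))
    (C := |x| ^ 3 * (1 + Real.exp x)) ?_
  · simpa using this
  · intro s hs
    rw [uIoc_of_le zero_le_one] at hs
    rw [← mul_sub, Real.norm_eq_abs, abs_mul]
    refine (mul_le_mul_of_nonneg_left (abs_exp_mul_sub_chord_le x ⟨hs.1.le, hs.2⟩)
      (abs_nonneg x)).trans_eq ?_
    rw [← sq_abs x]; ring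

/-! ### Third-order pointwise estimates for a pair of log-density values -/

section Pair

variable {a b u : ℝ}

lemma one_add_exp_add_le (a b : ℝ) :
    1 + Real.exp (a + b) ≤ (1 + Real.exp a) * (1 + Real.exp b) := by
  rw [Real.exp_add]
  nlinarith [Real.exp_pos a, Real.exp_pos b]

lemma abs_sub_mul_exp_sub_chord_le (h : |a| + |b| ≤ u) {s : ℝ} (hs : s ∈ Icc (0 : ℝ) 1) :
    |(|a - b| * Real.exp (s * (a + b))) -
      ((1 - s) * |a - b| + s * (|a - b| * Real.exp (a + b)))| ≤
      u ^ 3 * ((1 + Real.exp a) * (1 + Real.exp b)) := by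
  have h1 := abs_exp_mul_sub_chord_le (a + b) hs
  have h2 : |a - b| ≤ u := (abs_sub a b).trans h
  have h3 : (a + b) ^ 2 ≤ u ^ 2 := by
    rw [← sq_abs]; exact pow_le_pow_left₀ (abs_nonneg _) ((abs_add_le a b).trans h) 2
  have hu : 0 ≤ u := (abs_nonneg _).trans h2
  calc _ = |a - b| * |Real.exp (s * (a + b)) - ((1 - s) + s * Real.exp (a + b))| := by
        rw [← abs_abs (a - b), ← abs_mul, abs_abs]; congr 1; ring
    _ ≤ u * (u ^ 2 * ((1 + Real.exp a) * (1 + Real.exp b))) := by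
        refine mul_le_mul h2 (h1.trans ?_) (abs_nonneg _) (by positivity)
        exact mul_le_mul h3 (one_add_exp_add_le a b) (by positivity) (by positivity)
    _ = _ := by ring

/-- Factoring out `e^b` reduces this to the trapezoid estimate at `a - b`. -/
lemma abs_abs_exp_sub_exp_sub_trapezoid_le (h : |a| + |b| ≤ u) :
    |(|Real.exp a - Real.exp b|) - |a - b| * (Real.exp a + Real.exp b) / 2| ≤
      u ^ 3 * ((1 + Real.exp a) * (1 + Real.exp b)) := by
  have h2 : |a - b| ≤ u := (abs_sub a b).trans h
  have hu : 0 ≤ u := (abs_nonneg _).trans h2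
  have hab : Real.exp (a - b) * Real.exp b = Real.exp a := by
    rw [← Real.exp_add, sub_add_cancel]
  have e1 : |a - b| * (Real.exp a + Real.exp b) / 2 =
      |(a - b) * (Real.exp a + Real.exp b) / 2| := by
    rw [abs_div, abs_mul, abs_of_pos (by positivity : 0 < Real.exp a + Real.exp b)]; norm_num
  rw [e1]
  refine (abs_abs_sub_abs_le_abs_sub _ _).trans ?_
  have e2 : Real.exp a - Real.exp b - (a - b) * (Real.exp a + Real.exp b) / 2 =
      Real.exp b * (Real.exp (a - b) - 1 - (a - b) * (1 + Real.exp (a - b)) / 2) := by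
    rw [← hab]; ring
  rw [e2, abs_mul, abs_of_pos (Real.exp_pos b)]
  calc _ ≤ Real.exp b * (|a - b| ^ 3 * (1 + Real.exp (a - b))) :=
        mul_le_mul_of_nonneg_left (abs_exp_sub_one_sub_trapezoid_le _) (Real.exp_pos b).le
    _ = |a - b| ^ 3 * (Real.exp b + Real.exp a) := by rw [← hab]; ring
    _ ≤ _ := by
        refine mul_le_mul (pow_le_pow_left₀ (abs_nonneg _) h2 3) ?_ (by positivity) (by positivity)
        nlinarith [Real.exp_pos a, Real.exp_pos b, mul_pos (Real.exp_pos a) (Real.exp_pos b)]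

/-- The difference is exactly `-|a - b| (e^a - 1)(e^b - 1)`, a product of three first-order factors.
This links the trapezoid for `|e^a - e^b|` to the endpoint values of `|a - b| e^{s(a+b)}`. -/
lemma abs_sub_mul_exp_add_exp_sub_le (h : |a| + |b| ≤ u) :
    |(|a - b| * (Real.exp a + Real.exp b)) - (|a - b| + |a - b| * Real.exp (a + b))| ≤
      u ^ 3 * ((1 + Real.exp a) * (1 + Real.exp b)) := by
  have h2 : |a - b| ≤ u := (abs_sub a b).trans h
  have hu : 0 ≤ u := (abs_nonneg _).trans h2
  have ha : |a| ≤ u := by linarith [abs_nonneg b]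
  have hb : |b| ≤ u := by linarith [abs_nonneg a]
  have e : |a - b| * (Real.exp a + Real.exp b) - (|a - b| + |a - b| * Real.exp (a + b)) =
      -(|a - b| * ((Real.exp a - 1) * (Real.exp b - 1))) := by rw [Real.exp_add]; ring
  rw [e, abs_neg, abs_mul, abs_abs, abs_mul]
  have ha' := (abs_exp_sub_one_le_mul a).trans
    (mul_le_mul_of_nonneg_right ha (by positivity : 0 ≤ 1 + Real.exp a))
  have hb' := (abs_exp_sub_one_le_mul b).trans
    (mul_le_mul_of_nonneg_right hb (by positivity : 0 ≤ 1 + Real.exp b))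
  calc _ ≤ u * (u * (1 + Real.exp a) * (u * (1 + Real.exp b))) := by gcongr
    _ = _ := by ring

end Pair

/-! ### Comparison of the two sides on an abstract probability space -/

lemma abs_integral_sub_integral_le {Ω : Type*} [MeasurableSpace Ω] {P : Measure Ω}
    {f g k : Ω → ℝ} (hf : Integrable f P) (hg : Integrable g P) (hk : Integrable k P)
    (h : ∀ ω, |f ω - g ω| ≤ k ω) : |∫ ω, f ω ∂P - ∫ ω, g ω ∂P| ≤ ∫ ω, k ω ∂P := by
  rw [← integral_sub hf hg]
  exact (abs_integral_le_integral_abs).trans (integral_mono (hf.sub hg).abs hk h)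

/-- From `(v + 1)(v - 1)² ≥ 0`; lower moments are thereby absorbed into the third. -/
lemma self_le_one_add_pow_three {v : ℝ} (hv : 0 ≤ v) : v ≤ 1 + v ^ 3 := by
  nlinarith [mul_nonneg hv (sq_nonneg (v - 1)), sq_nonneg (v - 1)]

lemma sq_le_one_add_pow_three {v : ℝ} (hv : 0 ≤ v) : v ^ 2 ≤ 1 + v ^ 3 := by
  nlinarith [mul_nonneg hv (sq_nonneg (v - 1)), sq_nonneg (v - 1)]

/-- A dominating function free of `s`, used for integrability, for continuity in `s`, and for the
bound `G s = O(δ)`. -/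
lemma abs_sub_mul_exp_le {Ω : Type*} {a b v : Ω → ℝ} {δ : ℝ}
    (hv0 : ∀ ω, 0 ≤ v ω) (hδ : 0 ≤ δ)
    (hab : ∀ ω, |a ω| + |b ω| ≤ δ * v ω) {s : ℝ} (hs : s ∈ Icc (0 : ℝ) 1) (ω : Ω) :
    |a ω - b ω| * Real.exp (s * (a ω + b ω)) ≤
      δ * ((1 + Real.exp (a ω)) * (1 + Real.exp (b ω)) +
        v ω ^ 3 * ((1 + Real.exp (a ω)) * (1 + Real.exp (b ω)))) := by
  have h1 := (abs_sub (a ω) (b ω)).trans (hab ω)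
  have h2 := (exp_mul_le_one_add_exp (a ω + b ω) hs).trans (one_add_exp_add_le (a ω) (b ω))
  have h3 : δ * v ω ≤ δ * (1 + v ω ^ 3) :=
    mul_le_mul_of_nonneg_left (self_le_one_add_pow_three (hv0 ω)) hδ
  refine (mul_le_mul (h1.trans h3) h2 (Real.exp_pos _).le ?_).trans_eq (by ring)
  have := hv0 ω
  positivity

section Abstract

variable {Ω : Type*} [MeasurableSpace Ω] {P : Measure Ω} {a b v : Ω → ℝ} {δ : ℝ}

lemma integrable_abs_sub_mul_exp (ha : Measurable a) (hb : Measurable b)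
    (hv0 : ∀ ω, 0 ≤ v ω) (hδ : 0 ≤ δ) (hab : ∀ ω, |a ω| + |b ω| ≤ δ * v ω)
    (hw : Integrable (fun ω => (1 + Real.exp (a ω)) * (1 + Real.exp (b ω))) P)
    (hvw : Integrable (fun ω => v ω ^ 3 * ((1 + Real.exp (a ω)) * (1 + Real.exp (b ω)))) P)
    {s : ℝ} (hs : s ∈ Icc (0 : ℝ) 1) :
    Integrable (fun ω => |a ω - b ω| * Real.exp (s * (a ω + b ω))) P := by
  refine ((hw.add hvw).const_mul δ).mono' (by fun_prop) (ae_of_all _ fun ω => ?_)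
  rw [Real.norm_of_nonneg (by positivity)]
  exact abs_sub_mul_exp_le hv0 hδ hab hs ω

lemma continuousOn_integral_abs_sub_mul_exp (ha : Measurable a) (hb : Measurable b)
    (hv0 : ∀ ω, 0 ≤ v ω) (hδ : 0 ≤ δ) (hab : ∀ ω, |a ω| + |b ω| ≤ δ * v ω)
    (hw : Integrable (fun ω => (1 + Real.exp (a ω)) * (1 + Real.exp (b ω))) P)
    (hvw : Integrable (fun ω => v ω ^ 3 * ((1 + Real.exp (a ω)) * (1 + Real.exp (b ω)))) P) :
    ContinuousOn (fun s : ℝ => ∫ ω, |a ω - b ω| * Real.exp (s * (a ω + b ω)) ∂P) (Icc 0 1) := by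
  refine MeasureTheory.continuousOn_of_dominated (fun s _ => by fun_prop) (fun s hs =>
    ae_of_all _ fun ω => ?_) ((hw.add hvw).const_mul δ) (ae_of_all _ fun ω => by fun_prop)
  rw [Real.norm_of_nonneg (by positivity)]
  exact abs_sub_mul_exp_le hv0 hδ hab hs ω

/-- Trapezoidal comparison of `∫ |e^a - e^b|` with `∫₀¹ ∫ |a - b| e^{s (a + b)} / Z(s)² ds`. -/
lemma abs_integral_abs_exp_sub_sub_le (ha : Measurable a) (hb : Measurable b)
    (hv0 : ∀ ω, 0 ≤ v ω) (hδ : 0 ≤ δ) (hab : ∀ ω, |a ω| + |b ω| ≤ δ * v ω)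
    (hw : Integrable (fun ω => (1 + Real.exp (a ω)) * (1 + Real.exp (b ω))) P)
    (hvw : Integrable (fun ω => v ω ^ 3 * ((1 + Real.exp (a ω)) * (1 + Real.exp (b ω)))) P)
    {R Q : ℝ} (hR : ∫ ω, (1 + Real.exp (a ω)) * (1 + Real.exp (b ω)) ∂P ≤ R)
    (hQ : ∫ ω, v ω ^ 3 * ((1 + Real.exp (a ω)) * (1 + Real.exp (b ω))) ∂P ≤ Q)
    {Z : ℝ → ℝ} (hZ : ContinuousOn Z (Icc 0 1)) {c B : ℝ} (hc : 0 < c)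
    (hZc : ∀ s ∈ Icc (0 : ℝ) 1, c ≤ Z s) (hZ1 : ∀ s ∈ Icc (0 : ℝ) 1, Z s ≤ 1)
    (hZB : ∀ s ∈ Icc (0 : ℝ) 1, 1 - Z s ≤ B * δ ^ 2) :
    |∫ ω, |Real.exp (a ω) - Real.exp (b ω)| ∂P -
      ∫ s in (0 : ℝ)..1, (∫ ω, |a ω - b ω| * Real.exp (s * (a ω + b ω)) ∂P) / Z s ^ 2| ≤
      (3 * Q + (R + Q) * (2 * B / c ^ 2)) * δ ^ 3 := by
  have hint := fun {s : ℝ} (hs : s ∈ Icc (0 : ℝ) 1) =>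
    integrable_abs_sub_mul_exp (P := P) ha hb hv0 hδ hab hw hvw hs
  have hGcont := continuousOn_integral_abs_sub_mul_exp (P := P) ha hb hv0 hδ hab hw hvw
  set G : ℝ → ℝ := fun s => ∫ ω, |a ω - b ω| * Real.exp (s * (a ω + b ω)) ∂P with hG
  have hH0 : Integrable (fun ω => |a ω - b ω|) P := by
    simpa using hint (left_mem_Icc.2 zero_le_one)
  have hH1 : Integrable (fun ω => |a ω - b ω| * Real.exp (a ω + b ω)) P := by
    simpa using hint (right_mem_Icc.2 zero_le_one)
  have hG0 : G 0 = ∫ ω, |a ω - b ω| ∂P := by simp [hG]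
  have hG1 : G 1 = ∫ ω, |a ω - b ω| * Real.exp (a ω + b ω) ∂P := by simp [hG]
  have herr : ∫ ω, (δ * v ω) ^ 3 * ((1 + Real.exp (a ω)) * (1 + Real.exp (b ω))) ∂P ≤
      Q * δ ^ 3 := by
    have e : ∀ ω, (δ * v ω) ^ 3 * ((1 + Real.exp (a ω)) * (1 + Real.exp (b ω))) =
      δ ^ 3 * (v ω ^ 3 * ((1 + Real.exp (a ω)) * (1 + Real.exp (b ω)))) := fun ω => by ring
    simp_rw [e]
    rw [integral_const_mul, mul_comm]
    exact mul_le_mul_of_nonneg_right hQ (by positivity)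
  have hK : Integrable
      (fun ω => (δ * v ω) ^ 3 * ((1 + Real.exp (a ω)) * (1 + Real.exp (b ω)))) P := by
    refine (hvw.const_mul (δ ^ 3)).congr (ae_of_all _ fun ω => ?_)
    simp only; ring
  have hQ0 : 0 ≤ Q := (integral_nonneg fun ω => by have := hv0 ω; positivity).trans hQ
  have hea : Integrable (fun ω => Real.exp (a ω)) P := by
    refine hw.mono' (by fun_prop) (ae_of_all _ fun ω => ?_)
    rw [Real.norm_of_nonneg (by positivity)]
    nlinarith [Real.exp_pos (a ω), Real.exp_pos (b ω),
      mul_pos (Real.exp_pos (a ω)) (Real.exp_pos (b ω))]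
  have heb : Integrable (fun ω => Real.exp (b ω)) P := by
    refine hw.mono' (by fun_prop) (ae_of_all _ fun ω => ?_)
    rw [Real.norm_of_nonneg (by positivity)]
    nlinarith [Real.exp_pos (a ω), Real.exp_pos (b ω),
      mul_pos (Real.exp_pos (a ω)) (Real.exp_pos (b ω))]
  have hT : Integrable (fun ω => |a ω - b ω| * (Real.exp (a ω) + Real.exp (b ω))) P := by
    refine (hH0.add (hH1.add hK)).mono' (by fun_prop) (ae_of_all _ fun ω => ?_)
    have h := (abs_le.1 (abs_sub_mul_exp_add_exp_sub_le (hab ω))).2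
    rw [Real.norm_of_nonneg (by positivity)]
    simp only [Pi.add_apply]
    linarith
  have hT2 : Integrable (fun ω => |a ω - b ω| * (Real.exp (a ω) + Real.exp (b ω)) / 2) P :=
    hT.div_const 2
  have e1 : |∫ ω, |Real.exp (a ω) - Real.exp (b ω)| ∂P -
      (∫ ω, |a ω - b ω| * (Real.exp (a ω) + Real.exp (b ω)) ∂P) / 2| ≤ Q * δ ^ 3 := by
    rw [← integral_div]
    exact (abs_integral_sub_integral_le (hea.sub heb).abs hT2 hK
      fun ω => abs_abs_exp_sub_exp_sub_trapezoid_le (hab ω)).trans herr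
  have e2 : |∫ ω, |a ω - b ω| * (Real.exp (a ω) + Real.exp (b ω)) ∂P - (G 0 + G 1)| ≤
      Q * δ ^ 3 := by
    rw [hG0, hG1, ← integral_add hH0 hH1]
    exact (abs_integral_sub_integral_le hT (hH0.add hH1) hK
      fun ω => abs_sub_mul_exp_add_exp_sub_le (hab ω)).trans herr
  have e3 : ∀ s ∈ Icc (0 : ℝ) 1, |G s - ((1 - s) * G 0 + s * G 1)| ≤ Q * δ ^ 3 := by
    intro s hs
    rw [hG0, hG1, ← integral_const_mul, ← integral_const_mul,
      ← integral_add (hH0.const_mul _) (hH1.const_mul _)]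
    exact (abs_integral_sub_integral_le (hint hs) ((hH0.const_mul _).add (hH1.const_mul _)) hK
      fun ω => abs_sub_mul_exp_sub_chord_le (hab ω) hs).trans herr
  have hGle : ∀ s ∈ Icc (0 : ℝ) 1, G s ≤ δ * (R + Q) := by
    intro s hs
    refine (integral_mono (hint hs) ((hw.add hvw).const_mul δ)
      fun ω => abs_sub_mul_exp_le hv0 hδ hab hs ω).trans ?_
    simp only [Pi.add_apply]
    rw [integral_const_mul, integral_add hw hvw]
    gcongr
  have hGnn : ∀ s, 0 ≤ G s := fun s => integral_nonneg fun ω => by positivity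
  -- Effect of normalization: `1 / Z² - 1 = (1 + Z)(1 - Z) / Z²` is of order `δ²`, and `G s`
  -- contributes one more `δ`.
  have e4 : ∀ s ∈ Icc (0 : ℝ) 1, |G s / Z s ^ 2 - G s| ≤
      (R + Q) * (2 * B / c ^ 2) * δ ^ 3 := by
    intro s hs
    have hz := hZc s hs
    have hz0 : 0 < Z s := hc.trans_le hz
    have h1 : 1 / Z s ^ 2 - 1 ≤ 2 * (B * δ ^ 2) / c ^ 2 := by
      have : 1 / Z s ^ 2 - 1 = (1 + Z s) * (1 - Z s) / Z s ^ 2 := by field_simp; ring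
      rw [this]
      have hB := hZB s hs
      have hz1 := hZ1 s hs
      have : 0 ≤ 1 - Z s := by linarith
      gcongr <;> linarith
    have h0 : 0 ≤ 1 / Z s ^ 2 - 1 := by
      rw [sub_nonneg, le_div_iff₀ (by positivity), one_mul]
      exact pow_le_one₀ hz0.le (hZ1 s hs)
    have e : G s / Z s ^ 2 - G s = G s * (1 / Z s ^ 2 - 1) := by ring
    rw [e, abs_of_nonneg (mul_nonneg (hGnn s) h0)]
    refine (mul_le_mul (hGle s hs) h1 h0 ((hGnn s).trans (hGle s hs))).trans_eq (by ring)
  have e5 : ∀ s ∈ Icc (0 : ℝ) 1, |G s / Z s ^ 2 - ((1 - s) * G 0 + s * G 1)| ≤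
      (Q + (R + Q) * (2 * B / c ^ 2)) * δ ^ 3 := by
    intro s hs
    have h := abs_sub_le (G s / Z s ^ 2) (G s) ((1 - s) * G 0 + s * G 1)
    have h3 := e3 s hs
    have h4 := e4 s hs
    linarith
  have hcQ : ContinuousOn (fun s => G s / Z s ^ 2) (Icc 0 1) :=
    hGcont.div (hZ.pow 2) fun s hs => by have := hc.trans_le (hZc s hs); positivity
  have hiQ : IntervalIntegrable (fun s => G s / Z s ^ 2) volume 0 1 :=
    ContinuousOn.intervalIntegrable (by rwa [uIcc_of_le zero_le_one])
  have hcL : Continuous fun s : ℝ => (1 - s) * G 0 + s * G 1 := by fun_prop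
  have hL : ∫ s in (0 : ℝ)..1, ((1 - s) * G 0 + s * G 1) = (G 0 + G 1) / 2 := by
    rw [intervalIntegral.integral_eq_sub_of_hasDerivAt
      (f := fun s => (s - s ^ 2 / 2) * G 0 + s ^ 2 / 2 * G 1) _ (hcL.intervalIntegrable _ _)]
    · norm_num; ring
    · intro s _
      have hsq : HasDerivAt (fun s : ℝ => s ^ 2 / 2) s s := by
        have := (hasDerivAt_pow 2 s).div_const 2
        simpa using this
      exact (((hasDerivAt_id s).sub hsq).mul_const _).add (hsq.mul_const _)
  have e6 : |(∫ s in (0 : ℝ)..1, G s / Z s ^ 2) - (G 0 + G 1) / 2| ≤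
      (Q + (R + Q) * (2 * B / c ^ 2)) * δ ^ 3 := by
    rw [← hL, ← intervalIntegral.integral_sub hiQ (hcL.intervalIntegrable _ _)]
    have := intervalIntegral.norm_integral_le_of_norm_le_const (a := 0) (b := 1)
      (f := fun s : ℝ => G s / Z s ^ 2 - ((1 - s) * G 0 + s * G 1))
      (C := (Q + (R + Q) * (2 * B / c ^ 2)) * δ ^ 3) ?_
    · simpa using this
    · intro s hs
      rw [uIoc_of_le zero_le_one] at hs
      exact e5 s ⟨hs.1.le, hs.2⟩
  -- The multiples of `Q δ³` are `1` from `e1`, `1/2` from `e2` halved and `1` from `e6`, rounded up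
  -- to `3`.
  have hQδ : 0 ≤ Q * δ ^ 3 := by positivity
  rw [abs_le] at e1 e2 e6 ⊢
  constructor <;> linarith [e1.1, e1.2, e2.1, e2.2, e6.1, e6.2]

end Abstract

/-! ### Products of tilted measures -/

lemma prod_tilted {X Y : Type*} [MeasurableSpace X] [MeasurableSpace Y] (μ : Measure X)
    (ν : Measure Y) [SFinite μ] [SFinite ν] {f : X → ℝ} {g : Y → ℝ} (hf : Measurable f)
    (hg : Measurable g) :
    (μ.tilted f).prod (ν.tilted g) = (μ.prod ν).tilted (fun z => f z.1 + g z.2) := by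
  unfold Measure.tilted
  rw [prod_withDensity (by fun_prop) (by fun_prop)]
  congr 1
  ext z
  simp_rw [Real.exp_add]
  rw [integral_prod_mul (fun x => Real.exp (f x)) (fun y => Real.exp (g y)),
    ← ENNReal.ofReal_mul (by positivity)]
  congr 1
  ring

/-- Jensen's inequality, obtained by integrating the tangent line of `exp` at `-k`. -/
lemma exp_neg_le_integral_exp {X : Type*} [MeasurableSpace X] {ν : Measure X}
    [IsProbabilityMeasure ν] {f : X → ℝ} (hf : Integrable f ν)
    (hfe : Integrable (fun x => Real.exp (f x)) ν) {k : ℝ} (hk : -k ≤ ∫ x, f x ∂ν) :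
    Real.exp (-k) ≤ ∫ x, Real.exp (f x) ∂ν := by
  have h : ∫ x, Real.exp (-k) * (f x + (k + 1)) ∂ν ≤ ∫ x, Real.exp (f x) ∂ν := by
    refine integral_mono ((hf.add (integrable_const _)).const_mul _) hfe fun x => ?_
    have h1 := mul_le_mul_of_nonneg_left (Real.add_one_le_exp (f x + k)) (Real.exp_pos (-k)).le
    rw [← Real.exp_add] at h1
    calc _ = Real.exp (-k) * (f x + k + 1) := by ring
      _ ≤ _ := h1
      _ = _ := by congr 1; ring
  rw [integral_const_mul, integral_add hf (integrable_const _)] at h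
  simp only [integral_const, probReal_univ, one_smul] at h
  refine le_trans ?_ h
  have := mul_le_mul_of_nonneg_left (by linarith : 1 ≤ ∫ x, f x ∂ν + (k + 1))
    (Real.exp_pos (-k)).le
  linarith

/-! ### The swap rejection rate of two mutually tilted measures -/

/-- `D` is a log-density with respect to the probability measure `ν`, dominated by `δ V`, where
`V` has third moment at most `M` under `ν + e^D ν`. -/
structure IsDominatedLogDensity {X : Type*} [MeasurableSpace X] (ν : Measure X) (D V : X → ℝ)
    (δ M : ℝ) : Prop where
  measurable : Measurable D
  measurable_bound : Measurable V
  bound_nonneg : ∀ x, 0 ≤ V x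
  nonneg : 0 ≤ δ
  le_one : δ ≤ 1
  abs_le_mul : ∀ x, |D x| ≤ δ * V x
  integrable_exp : Integrable (fun x => Real.exp (D x)) ν
  integral_exp : ∫ x, Real.exp (D x) ∂ν = 1
  integrable_pow : Integrable (fun x => V x ^ 3 * (1 + Real.exp (D x))) ν
  integral_pow_le : ∫ x, V x ^ 3 * (1 + Real.exp (D x)) ∂ν ≤ M

namespace IsDominatedLogDensity

variable {X : Type*} [MeasurableSpace X] {ν : Measure X} {D V : X → ℝ}
  {δ M : ℝ}

lemma abs_le_one_add_pow_mul (h : IsDominatedLogDensity ν D V δ M) (x : X) :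
    |D x| ≤ (1 + V x ^ 3) * (1 + Real.exp (D x)) := by
  have hV := h.bound_nonneg x
  have h1 := h.abs_le_mul x
  have h2 := self_le_one_add_pow_three hV
  have h3 := mul_le_mul_of_nonneg_right h.le_one hV
  have h4 : 0 ≤ (1 + V x ^ 3) * Real.exp (D x) := by positivity
  linarith

lemma add_pow_three_mul_weight_le (h : IsDominatedLogDensity ν D V δ M) (z : X × X) :
    (V z.1 + V z.2) ^ 3 * ((1 + Real.exp (D z.1)) * (1 + Real.exp (D z.2))) ≤
      4 * ((V z.1 ^ 3 * (1 + Real.exp (D z.1))) * (1 + Real.exp (D z.2)) +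
        (1 + Real.exp (D z.1)) * (V z.2 ^ 3 * (1 + Real.exp (D z.2)))) := by
  have h1 : (V z.1 + V z.2) ^ 3 ≤ 4 * (V z.1 ^ 3 + V z.2 ^ 3) := by
    nlinarith [mul_nonneg (add_nonneg (h.bound_nonneg z.1) (h.bound_nonneg z.2))
      (sq_nonneg (V z.1 - V z.2))]
  refine (mul_le_mul_of_nonneg_right h1 (by positivity)).trans_eq (by ring)

lemma abs_add_abs_le (h : IsDominatedLogDensity ν D V δ M) (z : X × X) :
    |D z.1| + |D z.2| ≤ δ * (V z.1 + V z.2) := by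
  linarith [h.abs_le_mul z.1, h.abs_le_mul z.2]

variable [IsProbabilityMeasure ν]

lemma integrable_one_add_exp (h : IsDominatedLogDensity ν D V δ M) :
    Integrable (fun x => 1 + Real.exp (D x)) ν :=
  (integrable_const _).add h.integrable_exp

lemma integral_one_add_exp (h : IsDominatedLogDensity ν D V δ M) :
    ∫ x, (1 + Real.exp (D x)) ∂ν = 2 := by
  rw [integral_add (integrable_const _) h.integrable_exp, h.integral_exp]
  norm_num

lemma integrable_one_add_pow (h : IsDominatedLogDensity ν D V δ M) :
    Integrable (fun x => (1 + V x ^ 3) * (1 + Real.exp (D x))) ν :=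
  (h.integrable_one_add_exp.add h.integrable_pow).congr
    (ae_of_all _ fun x => by simp only [Pi.add_apply]; ring)

lemma integral_one_add_pow_le (h : IsDominatedLogDensity ν D V δ M) :
    ∫ x, (1 + V x ^ 3) * (1 + Real.exp (D x)) ∂ν ≤ 2 + M := by
  have e : ∀ x, (1 + V x ^ 3) * (1 + Real.exp (D x)) =
    (1 + Real.exp (D x)) + V x ^ 3 * (1 + Real.exp (D x)) := fun x => by ring
  simp_rw [e]
  rw [integral_add h.integrable_one_add_exp h.integrable_pow, h.integral_one_add_exp]
  linarith [h.integral_pow_le]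

lemma integrable_exp_mul (h : IsDominatedLogDensity ν D V δ M) {s : ℝ}
    (hs : s ∈ Icc (0 : ℝ) 1) : Integrable (fun x => Real.exp (s * D x)) ν := by
  have := h.measurable
  refine h.integrable_one_add_exp.mono' (by fun_prop) (ae_of_all _ fun x => ?_)
  rw [Real.norm_of_nonneg (by positivity)]
  exact exp_mul_le_one_add_exp _ hs

lemma integrable_chord (h : IsDominatedLogDensity ν D V δ M) (s : ℝ) :
    Integrable (fun x => (1 - s) + s * Real.exp (D x)) ν :=
  (integrable_const _).add (h.integrable_exp.const_mul s)

lemma integral_chord (h : IsDominatedLogDensity ν D V δ M) (s : ℝ) :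
    ∫ x, ((1 - s) + s * Real.exp (D x)) ∂ν = 1 := by
  rw [integral_add (integrable_const _) (h.integrable_exp.const_mul s), integral_const_mul,
    h.integral_exp]
  simp

lemma continuousOn_integral_exp_mul (h : IsDominatedLogDensity ν D V δ M) :
    ContinuousOn (fun s : ℝ => ∫ x, Real.exp (s * D x) ∂ν) (Icc 0 1) := by
  have := h.measurable
  refine MeasureTheory.continuousOn_of_dominated (fun s _ => by fun_prop) (fun s hs =>
    ae_of_all _ fun x => ?_) h.integrable_one_add_exp (ae_of_all _ fun x => by fun_prop)
  rw [Real.norm_of_nonneg (by positivity)]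
  exact exp_mul_le_one_add_exp _ hs

lemma integral_exp_mul_le_one (h : IsDominatedLogDensity ν D V δ M) {s : ℝ}
    (hs : s ∈ Icc (0 : ℝ) 1) : ∫ x, Real.exp (s * D x) ∂ν ≤ 1 :=
  (integral_mono (h.integrable_exp_mul hs) (h.integrable_chord s)
    fun _ => exp_mul_le_chord _ hs).trans_eq (h.integral_chord s)

/-- The chord of `e^{sD}` integrates to `1` for every `s`, so the defect is the integrated chord
error, at most `D² (1 + e^D)` pointwise. -/
lemma one_sub_integral_exp_mul_le (h : IsDominatedLogDensity ν D V δ M) {s : ℝ}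
    (hs : s ∈ Icc (0 : ℝ) 1) : 1 - ∫ x, Real.exp (s * D x) ∂ν ≤ (2 + M) * δ ^ 2 := by
  rw [← h.integral_chord s, ← integral_sub (h.integrable_chord s) (h.integrable_exp_mul hs)]
  calc _ ≤ ∫ x, δ ^ 2 * ((1 + V x ^ 3) * (1 + Real.exp (D x))) ∂ν := by
        refine integral_mono ((h.integrable_chord s).sub (h.integrable_exp_mul hs))
          (h.integrable_one_add_pow.const_mul _) fun x => (chord_sub_exp_mul_le (D x) hs).trans ?_
        have h1 : D x ^ 2 ≤ δ ^ 2 * (1 + V x ^ 3) := by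
          rw [← sq_abs]
          refine (pow_le_pow_left₀ (abs_nonneg _) (h.abs_le_mul x) 2).trans ?_
          rw [mul_pow]
          exact mul_le_mul_of_nonneg_left (sq_le_one_add_pow_three (h.bound_nonneg x))
            (sq_nonneg δ)
        have := mul_le_mul_of_nonneg_right h1 (by positivity : 0 ≤ 1 + Real.exp (D x))
        linarith
    _ ≤ _ := by
        rw [integral_const_mul, mul_comm]
        exact mul_le_mul_of_nonneg_right h.integral_one_add_pow_le (sq_nonneg δ)

/-- Jensen's inequality for `s D`; as `δ ≤ 1`, the lower bound depends on `M` alone. -/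
lemma exp_le_integral_exp_mul (h : IsDominatedLogDensity ν D V δ M) {s : ℝ}
    (hs : s ∈ Icc (0 : ℝ) 1) : Real.exp (-(2 + M)) ≤ ∫ x, Real.exp (s * D x) ∂ν := by
  have hD := h.measurable
  have hi : Integrable D ν := h.integrable_one_add_pow.mono' (by fun_prop)
    (ae_of_all _ fun x => h.abs_le_one_add_pow_mul x)
  refine exp_neg_le_integral_exp (hi.const_mul s) (h.integrable_exp_mul hs) ?_
  refine (abs_le.1 ?_).1
  refine abs_integral_le_integral_abs.trans ((integral_mono (hi.const_mul s).abs
    h.integrable_one_add_pow fun x => ?_).trans h.integral_one_add_pow_le)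
  have h1 := h.abs_le_one_add_pow_mul x
  have h2 := mul_le_mul_of_nonneg_right hs.2 (abs_nonneg (D x))
  simp only [abs_mul, abs_of_nonneg hs.1]
  linarith

lemma integrable_prod_weight (h : IsDominatedLogDensity ν D V δ M) :
    Integrable (fun z : X × X => (1 + Real.exp (D z.1)) * (1 + Real.exp (D z.2))) (ν.prod ν) :=
  h.integrable_one_add_exp.mul_prod h.integrable_one_add_exp

lemma integral_prod_weight (h : IsDominatedLogDensity ν D V δ M) :
    ∫ z : X × X, (1 + Real.exp (D z.1)) * (1 + Real.exp (D z.2)) ∂(ν.prod ν) = 4 := by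
  rw [integral_prod_mul (fun x => 1 + Real.exp (D x)) (fun x => 1 + Real.exp (D x)),
    h.integral_one_add_exp]
  norm_num

lemma integrable_prod_bound (h : IsDominatedLogDensity ν D V δ M) :
    Integrable (fun z : X × X => 4 * ((V z.1 ^ 3 * (1 + Real.exp (D z.1))) *
      (1 + Real.exp (D z.2)) +
        (1 + Real.exp (D z.1)) * (V z.2 ^ 3 * (1 + Real.exp (D z.2))))) (ν.prod ν) :=
  ((h.integrable_pow.mul_prod h.integrable_one_add_exp).add
    (h.integrable_one_add_exp.mul_prod h.integrable_pow)).const_mul 4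

lemma integrable_prod_pow (h : IsDominatedLogDensity ν D V δ M) :
    Integrable (fun z : X × X => (V z.1 + V z.2) ^ 3 *
      ((1 + Real.exp (D z.1)) * (1 + Real.exp (D z.2)))) (ν.prod ν) := by
  have hD := h.measurable
  have hV := h.measurable_bound
  refine h.integrable_prod_bound.mono' (by fun_prop) (ae_of_all _ fun z => ?_)
  have h1 := h.bound_nonneg z.1
  have h2 := h.bound_nonneg z.2
  rw [Real.norm_of_nonneg (by positivity)]
  exact h.add_pow_three_mul_weight_le z

lemma integral_prod_pow_le (h : IsDominatedLogDensity ν D V δ M) :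
    ∫ z : X × X, (V z.1 + V z.2) ^ 3 *
      ((1 + Real.exp (D z.1)) * (1 + Real.exp (D z.2))) ∂(ν.prod ν) ≤ 16 * M := by
  refine (integral_mono h.integrable_prod_pow h.integrable_prod_bound
    h.add_pow_three_mul_weight_le).trans ?_
  rw [integral_const_mul, integral_add (h.integrable_pow.mul_prod h.integrable_one_add_exp)
    (h.integrable_one_add_exp.mul_prod h.integrable_pow),
    integral_prod_mul (fun x => V x ^ 3 * (1 + Real.exp (D x))) (fun x => 1 + Real.exp (D x)),
    integral_prod_mul (fun x => 1 + Real.exp (D x)) (fun x => V x ^ 3 * (1 + Real.exp (D x))),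
    h.integral_one_add_exp]
  linarith [h.integral_pow_le]

lemma integrable_abs_sub_mul_exp_prod (h : IsDominatedLogDensity ν D V δ M) {s : ℝ}
    (hs : s ∈ Icc (0 : ℝ) 1) : Integrable
      (fun z : X × X => |D z.1 - D z.2| * Real.exp (s * (D z.1 + D z.2))) (ν.prod ν) :=
  integrable_abs_sub_mul_exp (a := fun z : X × X => D z.1) (b := fun z => D z.2)
    (v := fun z => V z.1 + V z.2) (h.measurable.comp measurable_fst)
    (h.measurable.comp measurable_snd)
    (fun z => add_nonneg (h.bound_nonneg z.1) (h.bound_nonneg z.2)) h.nonneg h.abs_add_abs_le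
    h.integrable_prod_weight h.integrable_prod_pow hs

lemma prod_tilted_mul (h : IsDominatedLogDensity ν D V δ M) (s : ℝ) :
    (ν.tilted fun x => s * D x).prod (ν.tilted fun x => s * D x) =
      (ν.prod ν).tilted fun z => s * (D z.1 + D z.2) := by
  rw [prod_tilted _ _ (h.measurable.const_mul s) (h.measurable.const_mul s)]
  congr 1
  ext z
  ring

lemma integrable_exp_mul_prod (h : IsDominatedLogDensity ν D V δ M) {s : ℝ}
    (hs : s ∈ Icc (0 : ℝ) 1) :
    Integrable (fun z : X × X => Real.exp (s * (D z.1 + D z.2))) (ν.prod ν) := by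
  simp_rw [mul_add, Real.exp_add]
  exact (h.integrable_exp_mul hs).mul_prod (h.integrable_exp_mul hs)

lemma integrable_abs_sub_tilted (h : IsDominatedLogDensity ν D V δ M) {s : ℝ}
    (hs : s ∈ Icc (0 : ℝ) 1) : Integrable (fun z : X × X => |D z.1 - D z.2|)
      ((ν.tilted fun x => s * D x).prod (ν.tilted fun x => s * D x)) := by
  rw [h.prod_tilted_mul, integrable_tilted_iff (h.integrable_exp_mul_prod hs)]
  simpa only [smul_eq_mul, mul_comm] using h.integrable_abs_sub_mul_exp_prod hs

lemma integral_abs_sub_tilted (h : IsDominatedLogDensity ν D V δ M) (s : ℝ) :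
    ∫ z : X × X, |D z.1 - D z.2|
      ∂((ν.tilted fun x => s * D x).prod (ν.tilted fun x => s * D x)) =
    (∫ z : X × X, |D z.1 - D z.2| * Real.exp (s * (D z.1 + D z.2)) ∂(ν.prod ν)) /
      (∫ x, Real.exp (s * D x) ∂ν) ^ 2 := by
  rw [h.prod_tilted_mul, integral_tilted, ← integral_div]
  have hZ : ∫ z : X × X, Real.exp (s * (D z.1 + D z.2)) ∂(ν.prod ν) =
      (∫ x, Real.exp (s * D x) ∂ν) ^ 2 := by
    simp_rw [mul_add, Real.exp_add]
    rw [integral_prod_mul (fun x => Real.exp (s * D x)) (fun x => Real.exp (s * D x)), sq]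
  rw [hZ]
  congr 1
  ext z
  rw [smul_eq_mul]
  ring

lemma intervalIntegrable_integral_abs_sub_tilted (h : IsDominatedLogDensity ν D V δ M) :
    IntervalIntegrable (fun s : ℝ => ∫ z : X × X, |D z.1 - D z.2|
      ∂((ν.tilted fun x => s * D x).prod (ν.tilted fun x => s * D x))) volume 0 1 := by
  simp_rw [h.integral_abs_sub_tilted]
  refine ContinuousOn.intervalIntegrable ?_
  rw [uIcc_of_le zero_le_one]
  refine ContinuousOn.div ?_ (h.continuousOn_integral_exp_mul.pow 2) fun s hs => ?_
  · exact continuousOn_integral_abs_sub_mul_exp (a := fun z : X × X => D z.1)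
      (b := fun z => D z.2)
      (v := fun z => V z.1 + V z.2) (h.measurable.comp measurable_fst)
      (h.measurable.comp measurable_snd)
      (fun z => add_nonneg (h.bound_nonneg z.1) (h.bound_nonneg z.2)) h.nonneg h.abs_add_abs_le
      h.integrable_prod_weight h.integrable_prod_pow
  · have := (Real.exp_pos _).trans_le (h.exp_le_integral_exp_mul hs)
    positivity

/-- The density `e^{D x'}` turns the acceptance probability into `min (e^{D x}) (e^{D x'})`, which
is half the sum minus half the absolute difference; both exponentials integrate to `1`. -/
lemma rejection_eq (h : IsDominatedLogDensity ν D V δ M) :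
    1 - ∫ z : X × X, Real.exp (min 0 (D z.1 - D z.2)) ∂(ν.prod (ν.tilted D)) =
      (1 / 2) * ∫ z : X × X, |Real.exp (D z.1) - Real.exp (D z.2)| ∂(ν.prod ν) := by
  have hD := h.measurable
  have e0 : ν.prod (ν.tilted D) = (ν.prod ν).tilted fun z => D z.2 := by
    have := prod_tilted ν ν (measurable_const (a := (0 : ℝ))) hD
    simpa using this
  have h1 : Integrable (fun z : X × X => Real.exp (D z.1)) (ν.prod ν) :=
    h.integrable_exp.comp_fst ν
  have h2 : Integrable (fun z : X × X => Real.exp (D z.2)) (ν.prod ν) :=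
    h.integrable_exp.comp_snd ν
  have i1 : ∫ z : X × X, Real.exp (D z.1) ∂(ν.prod ν) = 1 := by
    rw [integral_fun_fst (fun x => Real.exp (D x)), h.integral_exp]; simp
  have i2 : ∫ z : X × X, Real.exp (D z.2) ∂(ν.prod ν) = 1 := by
    rw [integral_fun_snd (fun x => Real.exp (D x)), h.integral_exp]; simp
  rw [e0, integral_tilted, i2]
  have e : ∀ z : X × X, (Real.exp (D z.2) / 1) • Real.exp (min 0 (D z.1 - D z.2)) =
      (Real.exp (D z.1) + Real.exp (D z.2)) / 2 -
        (1 / 2) * |Real.exp (D z.1) - Real.exp (D z.2)| := by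
    intro z
    rw [div_one, smul_eq_mul, ← Real.exp_add]
    rcases le_total (D z.1) (D z.2) with hle | hle
    · rw [min_eq_right (by linarith), abs_of_nonpos (by linarith [Real.exp_le_exp.2 hle]),
        add_sub_cancel]
      ring
    · rw [min_eq_left (by linarith), abs_of_nonneg (by linarith [Real.exp_le_exp.2 hle]),
        add_zero]
      ring
  simp_rw [e]
  have h3 : Integrable (fun z : X × X => (Real.exp (D z.1) + Real.exp (D z.2)) / 2)
      (ν.prod ν) := (h1.add h2).div_const 2
  have h4 : Integrable (fun z : X × X => (1 / 2) * |Real.exp (D z.1) - Real.exp (D z.2)|)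
      (ν.prod ν) := (h1.sub h2).abs.const_mul _
  rw [integral_sub h3 h4, integral_div,
    integral_add h1 h2, i1, i2, integral_const_mul]
  norm_num

/-- The rejection rate agrees with the barrier of the linear secant up to third order in `δ`. -/
lemma abs_rejection_sub_barrier_le (h : IsDominatedLogDensity ν D V δ M) :
    |(1 - ∫ z : X × X, Real.exp (min 0 (D z.1 - D z.2)) ∂(ν.prod (ν.tilted D))) -
      (1 / 2) * ∫ s in (0 : ℝ)..1, ∫ z : X × X, |D z.1 - D z.2|
        ∂((ν.tilted fun x => s * D x).prod (ν.tilted fun x => s * D x))| ≤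
    (1 / 2) * (3 * (16 * M) +
      (4 + 16 * M) * (2 * (2 + M) / Real.exp (-(2 + M)) ^ 2)) * δ ^ 3 := by
  -- Here `R = 4`, `Q = 16 M`, `c = e^{-(2+M)}` and `B = 2 + M`.
  have key := abs_integral_abs_exp_sub_sub_le (P := ν.prod ν) (a := fun z : X × X => D z.1)
    (b := fun z => D z.2) (v := fun z => V z.1 + V z.2) (h.measurable.comp measurable_fst)
    (h.measurable.comp measurable_snd)
    (fun z => add_nonneg (h.bound_nonneg z.1) (h.bound_nonneg z.2)) h.nonneg h.abs_add_abs_le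
    h.integrable_prod_weight h.integrable_prod_pow h.integral_prod_weight.le
    h.integral_prod_pow_le h.continuousOn_integral_exp_mul (Real.exp_pos _)
    (fun s hs => h.exp_le_integral_exp_mul hs) (fun s hs => h.integral_exp_mul_le_one hs)
    (fun s hs => h.one_sub_integral_exp_mul_le hs)
  rw [h.rejection_eq]
  simp_rw [h.integral_abs_sub_tilted]
  rw [← mul_sub, abs_mul, abs_of_pos (by norm_num : (0 : ℝ) < 1 / 2), mul_assoc]
  exact mul_le_mul_of_nonneg_left key (by norm_num)

end IsDominatedLogDensity

/-! ### Lipschitz bounds off a finite exceptional set -/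

/-- Mean value theorem between exceptional points: each interior one splits the interval, and
continuity glues the pieces. -/
lemma abs_sub_le_of_hasDerivAt_off_finset {f : ℝ → ℝ} {K : ℝ} (S : Finset ℝ) :
    ∀ {a b : ℝ}, a ≤ b → ContinuousOn f (Icc a b) →
      (∀ t ∈ Ioo a b, t ∉ S → ∃ d, HasDerivAt f d t ∧ |d| ≤ K) → |f b - f a| ≤ K * (b - a) := by
  induction S using Finset.induction_on with
  | empty =>
    intro a b hab hf h
    rcases hab.eq_or_lt with rfl | hlt
    · simp
    · obtain ⟨c, hc, hd⟩ := exists_deriv_eq_slope f hlt hf fun t ht =>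
        let ⟨_, hd, _⟩ := h t ht (by simp)
        hd.differentiableAt.differentiableWithinAt
      obtain ⟨d, hd', hK⟩ := h c hc (by simp)
      rw [hd'.deriv] at hd
      have hpos : 0 < b - a := sub_pos.2 hlt
      rw [hd, abs_div, abs_of_pos hpos, div_le_iff₀ hpos] at hK
      exact hK
  | insert s S hs ih =>
    intro a b hab hf h
    by_cases hsab : s ∈ Ioo a b
    · have h1 := ih hsab.1.le (hf.mono (Icc_subset_Icc_right hsab.2.le)) fun t ht htS =>
        h t ⟨ht.1, ht.2.trans hsab.2⟩ (by simp [htS, ht.2.ne])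
      have h2 := ih hsab.2.le (hf.mono (Icc_subset_Icc_left hsab.1.le)) fun t ht htS =>
        h t ⟨hsab.1.trans ht.1, ht.2⟩ (by simp [htS, ht.1.ne'])
      have h3 := abs_sub_le (f b) (f s) (f a)
      linarith
    · exact ih hab hf fun t ht htS =>
        h t ht (by simp only [Finset.mem_insert, not_or]; exact ⟨fun e => hsab (e ▸ ht), htS⟩)

lemma PiecewiseC1.exists_hasDerivAt_off_finset {f : ℝ → ℝ} (hf : PiecewiseC1 f) :
    ∃ S : Finset ℝ, ∀ t ∈ Icc (0 : ℝ) 1, t ∉ S → ∃ d, HasDerivAt f d t := by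
  obtain ⟨n, a, -, h0, h1, hpiece⟩ := hf
  refine ⟨Finset.univ.image a, fun t ht htS => ?_⟩
  have hne : ∀ i, a i ≠ t := fun i hi => htS (Finset.mem_image.2 ⟨i, Finset.mem_univ i, hi⟩)
  have hex : ∃ i : Fin n, t ∈ Ioo (a i.castSucc) (a i.succ) := by
    -- If no open piece contains `t`, induction along the partition keeps every `a i` below `t`, so
    -- the last point `1` equals `t`.
    by_contra! hno
    have hle : ∀ i, a i ≤ t := by
      intro i
      induction i using Fin.induction with
      | zero => rw [h0]; exact ht.1
      | succ i ih =>
        by_contra! hlt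
        exact hno i ⟨ih.lt_of_ne (hne _), hlt⟩
    exact hne (Fin.last n) (le_antisymm (hle _) (h1 ▸ ht.2))
  obtain ⟨i, hi⟩ := hex
  obtain ⟨g, hg, hfg⟩ := hpiece i
  have hd : DifferentiableAt ℝ g t :=
    (hg.differentiableOn (by norm_num) t ⟨hi.1.le, hi.2.le⟩).differentiableAt
      (Icc_mem_nhds hi.1 hi.2)
  exact ⟨_, hd.hasDerivAt.congr_of_eventuallyEq (hfg.eventuallyEq_of_mem (Ioo_mem_nhds hi.1 hi.2))⟩

/-- `f` and `g` may each jump; only their difference is continuous. It is applied to `W` at `x` and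
at a base point `x₀`. -/
lemma abs_sub_sub_sub_le_of_piecewiseC1 {f g : ℝ → ℝ} (hf : PiecewiseC1 f) (hg : PiecewiseC1 g)
    (hfg : ContinuousOn (fun t => f t - g t) (Icc 0 1)) {K L : ℝ}
    (hK : ∀ t ∈ Icc (0 : ℝ) 1, ∀ d, HasDerivWithinAt f d (Icc 0 1) t → |d| ≤ K)
    (hL : ∀ t ∈ Icc (0 : ℝ) 1, ∀ d, HasDerivWithinAt g d (Icc 0 1) t → |d| ≤ L)
    {t t' : ℝ} (ht : t ∈ Icc (0 : ℝ) 1) (ht' : t' ∈ Icc (0 : ℝ) 1) :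
    |(f t' - f t) - (g t' - g t)| ≤ (K + L) * |t - t'| := by
  classical
  obtain ⟨S, hS⟩ := hf.exists_hasDerivAt_off_finset
  obtain ⟨T, hT⟩ := hg.exists_hasDerivAt_off_finset
  have key : ∀ {a b : ℝ}, a ∈ Icc (0 : ℝ) 1 → b ∈ Icc (0 : ℝ) 1 → a ≤ b →
      |(f b - g b) - (f a - g a)| ≤ (K + L) * (b - a) := by
    intro a b ha hb hab
    refine abs_sub_le_of_hasDerivAt_off_finset (S ∪ T) hab (hfg.mono (Icc_subset_Icc ha.1 hb.2))
      fun t ht htST => ?_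
    simp only [Finset.mem_union, not_or] at htST
    have htI : t ∈ Icc (0 : ℝ) 1 := ⟨ha.1.trans ht.1.le, ht.2.le.trans hb.2⟩
    obtain ⟨d, hd⟩ := hS t htI htST.1
    obtain ⟨e, he⟩ := hT t htI htST.2
    exact ⟨d - e, hd.sub he, (abs_sub d e).trans
      (add_le_add (hK t htI d hd.hasDerivWithinAt) (hL t htI e he.hasDerivWithinAt))⟩
  rcases le_total t t' with h | h
  · have := key ht ht' h
    rw [abs_of_nonpos (sub_nonpos.2 h)]
    calc _ = |(f t' - g t') - (f t - g t)| := by congr 1; ring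
      _ ≤ _ := this
      _ = _ := by ring
  · have := key ht' ht h
    rw [abs_of_nonneg (sub_nonneg.2 h)]
    calc _ = |(f t - g t) - (f t' - g t')| := by rw [abs_sub_comm]; congr 1; ring
      _ ≤ _ := this

/-! ### Normalization of a log-density -/

lemma tilted_add_const {X : Type*} [MeasurableSpace X] (μ : Measure X) (f : X → ℝ) (c : ℝ) :
    μ.tilted (fun x => f x + c) = μ.tilted f := by
  unfold Measure.tilted
  simp_rw [Real.exp_add]
  rw [integral_mul_const]
  simp_rw [mul_div_mul_right _ _ (Real.exp_pos c).ne']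

lemma add_pow_three_le {a b : ℝ} (ha : 0 ≤ a) (hb : 0 ≤ b) :
    (a + b) ^ 3 ≤ 4 * (a ^ 3 + b ^ 3) := by
  nlinarith [mul_nonneg (add_nonneg ha hb) (sq_nonneg (a - b))]

lemma integrable_add_const_pow_three {X : Type*} [MeasurableSpace X] {ν : Measure X}
    [IsProbabilityMeasure ν] {U : X → ℝ} (hU : Measurable U) (hU0 : ∀ x, 0 ≤ U x)
    (hi : Integrable (fun x => U x ^ 3) ν) {c : ℝ} (hc : 0 ≤ c) :
    Integrable (fun x => (U x + c) ^ 3) ν := by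
  refine ((hi.add (integrable_const (c ^ 3))).const_mul 4).mono' (by fun_prop)
    (ae_of_all _ fun x => ?_)
  rw [Real.norm_of_nonneg (pow_nonneg (add_nonneg (hU0 x) hc) 3)]
  exact add_pow_three_le (hU0 x) hc

lemma integral_add_const_pow_three_le {X : Type*} [MeasurableSpace X] {ν : Measure X}
    [IsProbabilityMeasure ν] {U : X → ℝ} (hU : Measurable U) (hU0 : ∀ x, 0 ≤ U x)
    (hi : Integrable (fun x => U x ^ 3) ν) {c M : ℝ} (hc : 0 ≤ c)
    (hM : ∫ x, U x ^ 3 ∂ν ≤ M) : ∫ x, (U x + c) ^ 3 ∂ν ≤ 4 * (M + c ^ 3) := by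
  refine (integral_mono (integrable_add_const_pow_three hU hU0 hi hc)
    ((hi.add (integrable_const (c ^ 3))).const_mul 4)
    fun x => add_pow_three_le (hU0 x) hc).trans ?_
  simp only [Pi.add_apply]
  rw [integral_const_mul, integral_add hi (integrable_const _)]
  simp only [integral_const, probReal_univ, one_smul]
  linarith

lemma abs_integral_le_of_abs_le_mul {X : Type*} [MeasurableSpace X] {ν : Measure X}
    [IsProbabilityMeasure ν] {F U : X → ℝ} (hF : Measurable F) (hU0 : ∀ x, 0 ≤ U x)
    (hi : Integrable (fun x => U x ^ 3) ν) {δ M : ℝ} (hδ : 0 ≤ δ) (hM : ∫ x, U x ^ 3 ∂ν ≤ M)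
    (hFU : ∀ x, |F x| ≤ δ * U x) : Integrable F ν ∧ |∫ x, F x ∂ν| ≤ δ * (1 + M) := by
  have hb : Integrable (fun x => δ * (1 + U x ^ 3)) ν :=
    ((integrable_const (1 : ℝ)).add hi).const_mul δ
  have hle : ∀ x, |F x| ≤ δ * (1 + U x ^ 3) := fun x => (hFU x).trans
    (mul_le_mul_of_nonneg_left (self_le_one_add_pow_three (hU0 x)) hδ)
  have hFi : Integrable F ν := hb.mono' hF.aestronglyMeasurable (ae_of_all _ hle)
  refine ⟨hFi, abs_integral_le_integral_abs.trans ((integral_mono hFi.abs hb hle).trans ?_)⟩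
  rw [integral_const_mul, integral_add (integrable_const _) hi]
  simp only [integral_const, probReal_univ, one_smul]
  gcongr

/-- Normalizing `F` shifts it by `log E`, which is at most `δ (1 + M)` in absolute value; hence the
summand `1 + M` in the new bound. The factor `8` is `4` from the cube of a sum, once for `ν` and
once for the tilted law. -/
lemma isDominatedLogDensity_sub_log {X : Type*} [MeasurableSpace X] {ν : Measure X}
    [IsProbabilityMeasure ν] {F U : X → ℝ} {δ M : ℝ} (hF : Measurable F) (hU : Measurable U)
    (hU0 : ∀ x, 0 ≤ U x) (hδ : 0 ≤ δ) (hδ1 : δ ≤ 1) (hFU : ∀ x, |F x| ≤ δ * U x)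
    (hFe : Integrable (fun x => Real.exp (F x)) ν)
    (hi : Integrable (fun x => U x ^ 3) ν) (hM : ∫ x, U x ^ 3 ∂ν ≤ M)
    (hi' : Integrable (fun x => U x ^ 3) (ν.tilted F)) (hM' : ∫ x, U x ^ 3 ∂(ν.tilted F) ≤ M) :
    IsDominatedLogDensity ν (fun x => F x - Real.log (∫ y, Real.exp (F y) ∂ν))
      (fun x => U x + (1 + M)) δ (8 * (M + (1 + M) ^ 3)) := by
  have hprob : IsProbabilityMeasure (ν.tilted F) := isProbabilityMeasure_tilted hFe
  have hM0 : 0 ≤ M := (integral_nonneg fun x => pow_nonneg (hU0 x) 3).trans hM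
  set E := ∫ y, Real.exp (F y) ∂ν with hE
  have hEpos : 0 < E := integral_exp_pos hFe
  have hlow : -(δ * (1 + M)) ≤ Real.log E := by
    obtain ⟨h1, h2⟩ := abs_integral_le_of_abs_le_mul hF hU0 hi hδ hM hFU
    rw [Real.le_log_iff_exp_le hEpos]
    exact exp_neg_le_integral_exp h1 hFe (abs_le.1 h2).1
  -- Jensen for `-F` under the tilted law, where `e^{-F}` has integral `1 / E`.
  have hup : Real.log E ≤ δ * (1 + M) := by
    obtain ⟨h1, h2⟩ := abs_integral_le_of_abs_le_mul hF.neg hU0 hi' hδ hM'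
      (fun x => by simpa using hFU x)
    have h3 : Integrable (fun x => Real.exp ((-F) x)) (ν.tilted F) := by
      rw [integrable_tilted_iff hFe]
      simp [← Real.exp_add]
    have h4 := exp_neg_le_integral_exp h1 h3 (abs_le.1 h2).1
    rw [integral_exp_tilted] at h4
    simp only [add_neg_cancel, Pi.zero_apply, Real.exp_zero, integral_const, probReal_univ,
      one_smul] at h4
    rw [← hE, Real.exp_neg, one_div, inv_le_inv₀ (Real.exp_pos _) hEpos] at h4
    rwa [Real.log_le_iff_le_exp hEpos]
  have hDe : ∀ x, Real.exp (F x - Real.log E) = Real.exp (F x) / E := fun x => by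
    rw [Real.exp_sub, Real.exp_log hEpos]
  have hk : (0 : ℝ) ≤ 1 + M := by linarith
  have hVi := integrable_add_const_pow_three hU hU0 hi hk
  have hVi' := integrable_add_const_pow_three hU hU0 hi' hk
  have e : ∀ x, (U x + (1 + M)) ^ 3 * (1 + Real.exp (F x - Real.log E)) =
      (U x + (1 + M)) ^ 3 + (Real.exp (F x) / E) • (U x + (1 + M)) ^ 3 := fun x => by
    rw [hDe, smul_eq_mul]; ring
  have hVe : Integrable (fun x => (Real.exp (F x) / E) • (U x + (1 + M)) ^ 3) ν := by
    refine (((integrable_tilted_iff hFe _).1 hVi').div_const E).congr (ae_of_all _ fun x => ?_)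
    simp only [smul_eq_mul]; ring
  refine ⟨hF.sub_const _, hU.add_const _, fun x => add_nonneg (hU0 x) hk, hδ, hδ1, fun x => ?_,
    ?_, ?_, ?_, ?_⟩
  · have h1 := abs_sub (F x) (Real.log E)
    have h2 := abs_le.2 ⟨hlow, hup⟩
    have h3 := hFU x
    rw [mul_add]
    linarith
  · simp_rw [hDe]
    exact hFe.div_const E
  · simp_rw [hDe]
    rw [integral_div, div_self hEpos.ne']
  · simp_rw [e]
    exact hVi.add hVe
  · simp_rw [e]
    rw [integral_add hVi hVe, ← integral_tilted]
    linarith [integral_add_const_pow_three_le hU hU0 hi hk hM,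
      integral_add_const_pow_three_le hU hU0 hi' hk hM']

/-! ### Annealing paths -/

/-- Without integrability the Bochner integral is `0`, and division by zero makes the density
vanish, contradicting positivity at `x₀`. -/
lemma IsFullDensity.integrable_exp {X : Type*} [MeasurableSpace X] {μ : Measure X} {w : X → ℝ}
    (h : IsFullDensity μ (normalizedDensity μ w)) (x₀ : X) :
    Integrable (fun x => Real.exp (w x)) μ := by
  by_contra hn
  have := h.pos x₀
  rw [normalizedDensity, integral_undef hn, div_zero] at this
  exact this.false

lemma IsFullDensity.integral_exp_pos {X : Type*} [MeasurableSpace X] {μ : Measure X} {w : X → ℝ}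
    (h : IsFullDensity μ (normalizedDensity μ w)) (x₀ : X) :
    0 < ∫ x, Real.exp (w x) ∂μ :=
  (div_pos_iff_of_pos_left (Real.exp_pos _)).1 (h.pos x₀)

lemma IsFullDensity.log_normalizedDensity {X : Type*} [MeasurableSpace X] {μ : Measure X}
    {w : X → ℝ} (h : IsFullDensity μ (normalizedDensity μ w)) (x : X) :
    Real.log (normalizedDensity μ w x) = w x - Real.log (∫ y, Real.exp (w y) ∂μ) := by
  rw [normalizedDensity, Real.log_div (Real.exp_pos _).ne' (h.integral_exp_pos x).ne',
    Real.log_exp]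

lemma IsFullDensity.measurable_logDensity {X : Type*} [MeasurableSpace X] {μ : Measure X}
    {w : X → ℝ} (h : IsFullDensity μ (normalizedDensity μ w)) : Measurable w := by
  have h1 := h.measurable.log.add_const (Real.log (∫ y, Real.exp (w y) ∂μ))
  simpa only [h.log_normalizedDensity, sub_add_cancel] using h1

lemma IsFullDensity.nonempty {X : Type*} [MeasurableSpace X] {μ : Measure X} {p : X → ℝ}
    (h : IsFullDensity μ p) : Nonempty X := by
  by_contra hn
  rw [not_nonempty_iff] at hn
  have := h.lintegral_eq_one
  simp at this

lemma isFullDensity_normalizedDensity {X : Type*} [MeasurableSpace X] {μ : Measure X} [NeZero μ]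
    {w : X → ℝ} (hw : Measurable w) (hi : Integrable (fun x => Real.exp (w x)) μ) :
    IsFullDensity μ (normalizedDensity μ w) := by
  have hpos : 0 < ∫ x, Real.exp (w x) ∂μ := MeasureTheory.integral_exp_pos hi
  refine ⟨hw.exp.div_const _, fun x => div_pos (Real.exp_pos _) hpos, ?_⟩
  have := isProbabilityMeasure_tilted hi
  have h1 : μ.tilted w univ = 1 := measure_univ
  rwa [tilted_apply' _ _ MeasurableSet.univ, setLIntegral_univ] at h1

lemma IsFullDensity.secant {X : Type*} [MeasurableSpace X] {μ : Measure X} [NeZero μ]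
    {W : ℝ → X → ℝ} {t t' s : ℝ} (h : IsFullDensity μ (normalizedDensity μ (W t)))
    (h' : IsFullDensity μ (normalizedDensity μ (W t'))) (x₀ : X) (hs : s ∈ Icc (0 : ℝ) 1) :
    IsFullDensity μ (normalizedDensity μ (secant W t t' s)) := by
  have hm : Measurable (_root_.secant W t t' s) :=
    (h.measurable_logDensity.const_mul _).add (h'.measurable_logDensity.const_mul _)
  refine isFullDensity_normalizedDensity hm ?_
  refine (((h.integrable_exp x₀).const_mul (1 - s)).add
    ((h'.integrable_exp x₀).const_mul s)).mono' hm.exp.aestronglyMeasurable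
    (ae_of_all _ fun x => ?_)
  rw [Real.norm_of_nonneg (Real.exp_pos _).le]
  exact convexOn_exp.2 (mem_univ (W t x)) (mem_univ (W t' x)) (sub_nonneg.2 hs.2) hs.1 (by ring)

lemma integrable_coe_pow_of_lintegral_le {X : Type*} [MeasurableSpace X] {ν : Measure X}
    {V : X → ℝ≥0} (hV : Measurable V) (n : ℕ) {B : ℝ≥0∞} (hB : B ≠ ⊤)
    (h : ∫⁻ x, (V x : ℝ≥0∞) ^ n ∂ν ≤ B) :
    Integrable (fun x => (V x : ℝ) ^ n) ν ∧ ∫ x, (V x : ℝ) ^ n ∂ν ≤ B.toReal := by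
  have e : ∀ x, ENNReal.ofReal ((V x : ℝ) ^ n) = (V x : ℝ≥0∞) ^ n := fun x => by
    rw [ENNReal.ofReal_pow (V x).coe_nonneg, ENNReal.ofReal_coe_nnreal]
  have hm : AEStronglyMeasurable (fun x => (V x : ℝ) ^ n) ν := by fun_prop
  have h0 : ∀ x, 0 ≤ (V x : ℝ) ^ n := fun x => by positivity
  constructor
  · refine ⟨hm, ?_⟩
    rw [hasFiniteIntegral_iff_ofReal (ae_of_all _ h0)]
    simp_rw [e]
    exact h.trans_lt hB.lt_top
  · rw [integral_eq_lintegral_of_nonneg_ae (ae_of_all _ h0) hm]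
    simp_rw [e]
    exact ENNReal.toReal_mono hB h

/-- Up to an additive constant, `W t' - W t` is a log-density of `π_{t'}` with respect to `π_t`
that is of size `|t - t'|`, with moments bounded uniformly in `t` and `t'`. -/
lemma exists_isDominatedLogDensity {X : Type*} [MeasurableSpace X] (μ : Measure X) (W : ℝ → X → ℝ)
    (hpath : IsAnnealingPath μ (fun t => normalizedDensity μ (W t)))
    (hW : ∀ x, PiecewiseC1 (fun t => W t x))
    (V₁ : X → ℝ≥0) (hV_meas : Measurable V₁)
    (hV_bound : ∀ x, ∀ t ∈ Icc (0 : ℝ) 1, ∀ d : ℝ,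
      HasDerivWithinAt (fun u => W u x) d (Icc 0 1) t → |d| ≤ V₁ x)
    (hV_int : (⨆ t ∈ Icc (0 : ℝ) 1, ∫⁻ x, (V₁ x : ℝ≥0∞) ^ 3 ∂(μ.tilted (W t))) < ⊤) (x₀ : X) :
    ∃ (M : ℝ) (V : X → ℝ), ∀ t ∈ Icc (0 : ℝ) 1, ∀ t' ∈ Icc (0 : ℝ) 1, ∃ c : ℝ,
      IsDominatedLogDensity (μ.tilted (W t)) (fun x => W t' x - W t x + c) V |t - t'| M := by
  set B := ⨆ t ∈ Icc (0 : ℝ) 1, ∫⁻ x, (V₁ x : ℝ≥0∞) ^ 3 ∂(μ.tilted (W t)) with hB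
  have hmom := fun {t : ℝ} (ht : t ∈ Icc (0 : ℝ) 1) =>
    integrable_coe_pow_of_lintegral_le (ν := μ.tilted (W t)) hV_meas 3 hV_int.ne
      (le_iSup₂ (f := fun t (_ : t ∈ Icc (0 : ℝ) 1) =>
        ∫⁻ x, (V₁ x : ℝ≥0∞) ^ 3 ∂(μ.tilted (W t))) t ht)
  -- Bounds the third moment of the Lipschitz constant `V₁ x + V₁ x₀` under every `π_t`.
  set M := 4 * (B.toReal + (V₁ x₀ : ℝ) ^ 3) with hM
  have hμ : NeZero μ := ⟨by
    rintro rfl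
    simpa using (hpath.density 0 (left_mem_Icc.2 zero_le_one)).lintegral_eq_one⟩
  have hVm : Measurable fun x => (V₁ x : ℝ) := by fun_prop
  refine ⟨8 * (M + (1 + M) ^ 3), fun x => (V₁ x : ℝ) + V₁ x₀ + (1 + M), fun t ht t' ht' => ?_⟩
  have hd := hpath.density t ht
  have hd' := hpath.density t' ht'
  have hexp := hd.integrable_exp x₀
  have hexp' := hd'.integrable_exp x₀
  have hprob : IsProbabilityMeasure (μ.tilted (W t)) := isProbabilityMeasure_tilted hexp
  have hprob' : IsProbabilityMeasure (μ.tilted (W t')) := isProbabilityMeasure_tilted hexp'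
  set F : X → ℝ := fun x => (W t' x - W t x) - (W t' x₀ - W t x₀) with hF
  have hFm : Measurable F :=
    (hd'.measurable_logDensity.sub hd.measurable_logDensity).sub_const _
  -- This is `log π_u(x) - log π_u(x₀)`: the possibly discontinuous normalizing constant cancels.
  have hcont : ∀ x, ContinuousOn (fun u => W u x - W u x₀) (Icc 0 1) := by
    intro x
    have h := fun y => (hpath.continuousOn y).log
      fun u hu => ((hpath.density u hu).pos y).ne'
    refine ((h x).sub (h x₀)).congr fun u hu => ?_
    have e := fun y => (hpath.density u hu).log_normalizedDensity y
    rw [Pi.sub_apply, e, e]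
    ring
  have hFU : ∀ x, |F x| ≤ |t - t'| * ((V₁ x : ℝ) + V₁ x₀) := fun x => by
    rw [mul_comm]
    exact abs_sub_sub_sub_le_of_piecewiseC1 (hW x) (hW x₀) (hcont x) (hV_bound x) (hV_bound x₀)
      ht ht'
  have hsum : W t + F = fun x => W t' x + -(W t' x₀ - W t x₀) := by
    ext x
    simp only [hF, Pi.add_apply]
    ring
  have htilt : (μ.tilted (W t)).tilted F = μ.tilted (W t') := by
    rw [tilted_tilted hexp, hsum, tilted_add_const]
  have hFe : Integrable (fun x => Real.exp (F x)) (μ.tilted (W t)) := by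
    rw [integrable_tilted_iff hexp]
    simp_rw [smul_eq_mul, ← Real.exp_add]
    refine (hexp'.mul_const (Real.exp (-(W t' x₀ - W t x₀)))).congr (ae_of_all _ fun x => ?_)
    simp only [← Real.exp_add]
    congr 1
    exact (congrFun hsum x).symm
  have hδ1 : |t - t'| ≤ 1 := abs_le.2 ⟨by linarith [ht.1, ht'.2], by linarith [ht.2, ht'.1]⟩
  have hV0 : ∀ x, 0 ≤ (V₁ x : ℝ) := fun x => (V₁ x).coe_nonneg
  have hUi := integrable_add_const_pow_three hVm hV0 (hmom ht).1 (hV0 x₀)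
  have hUi' := integrable_add_const_pow_three hVm hV0 (hmom ht').1 (hV0 x₀)
  have hUM := integral_add_const_pow_three_le hVm hV0 (hmom ht).1 (hV0 x₀) (hmom ht).2
  have hUM' := integral_add_const_pow_three_le hVm hV0 (hmom ht').1 (hV0 x₀) (hmom ht').2
  rw [← htilt] at hUi' hUM'
  have key := isDominatedLogDensity_sub_log hFm (hVm.add_const _)
    (fun x => add_nonneg (hV0 x) (hV0 x₀)) (abs_nonneg _) hδ1 hFU hFe hUi hUM hUi' hUM'
  refine ⟨-(W t' x₀ - W t x₀) - Real.log (∫ y, Real.exp (F y) ∂(μ.tilted (W t))), ?_⟩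
  convert key using 1
  ext x
  simp only [hF]
  ring

theorem lemma1 {X : Type*} [MeasurableSpace X] (μ : Measure X) (W : ℝ → X → ℝ)
    (hpath : IsAnnealingPath μ (fun t => normalizedDensity μ (W t)))
    (hW : ∀ x, PiecewiseC1 (fun t => W t x))
    (V₁ : X → ℝ≥0) (hV_meas : Measurable V₁)
    (hV_bound : ∀ x, ∀ t ∈ Icc (0 : ℝ) 1, ∀ d : ℝ,
      HasDerivWithinAt (fun u => W u x) d (Icc 0 1) t → |d| ≤ V₁ x)
    (hV_int : (⨆ t ∈ Icc (0 : ℝ) 1, ∫⁻ x, (V₁ x : ℝ≥0∞) ^ 3 ∂(μ.tilted (W t))) < ⊤) :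
    -- the secant distributions and the integrals in the secant barrier are well defined
    (∀ t ∈ Icc (0 : ℝ) 1, ∀ t' ∈ Icc (0 : ℝ) 1,
      (∀ s ∈ Icc (0 : ℝ) 1,
        IsFullDensity μ (normalizedDensity μ (secant W t t' s)) ∧
        Integrable (fun z : X × X => |logAcceptance W t t' z.1 z.2|) (secantPair μ W t t' s)) ∧
      IntervalIntegrable
        (fun s => ∫ z, |logAcceptance W t t' z.1 z.2| ∂(secantPair μ W t t' s)) volume 0 1) ∧
    ∃ C : ℝ, ∀ t ∈ Icc (0 : ℝ) 1, ∀ t' ∈ Icc (0 : ℝ) 1,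
      |rejectionRate μ W t t' - secantBarrier μ W t t'| ≤ C * |t - t'| ^ 3 := by
  obtain ⟨x₀⟩ := (hpath.density 0 (left_mem_Icc.2 zero_le_one)).nonempty
  have hμ : NeZero μ := ⟨by
    rintro rfl
    simpa using (hpath.density 0 (left_mem_Icc.2 zero_le_one)).lintegral_eq_one⟩
  obtain ⟨M, V, hMV⟩ :=
    exists_isDominatedLogDensity μ W hpath hW V₁ hV_meas hV_bound hV_int x₀
  choose! c hc using hMV
  have hprob : ∀ t ∈ Icc (0 : ℝ) 1, IsProbabilityMeasure (μ.tilted (W t)) := fun t ht =>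
    isProbabilityMeasure_tilted ((hpath.density t ht).integrable_exp x₀)
  -- The constant `c t t'` cancels in the difference, and tilting ignores it, so everything is
  -- expressed through the normalized log-density.
  have hA : ∀ t t', ∀ z : X × X, logAcceptance W t t' z.1 z.2 =
      (W t' z.1 - W t z.1 + c t t') - (W t' z.2 - W t z.2 + c t t') := fun t t' z => by
    rw [logAcceptance]; ring
  have hsec : ∀ t ∈ Icc (0 : ℝ) 1, ∀ t' s,
      (μ.tilted (W t)).tilted (fun x => s * (W t' x - W t x + c t t')) =
        μ.tilted (secant W t t' s) := fun t ht t' s => by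
    rw [tilted_tilted ((hpath.density t ht).integrable_exp x₀),
      ← tilted_add_const μ (secant W t t' s) (s * c t t')]
    congr 1
    ext x
    simp only [secant, Pi.add_apply]
    ring
  have hend : ∀ t ∈ Icc (0 : ℝ) 1, ∀ t',
      (μ.tilted (W t)).tilted (fun x => W t' x - W t x + c t t') = μ.tilted (W t') :=
    fun t ht t' => by
      rw [tilted_tilted ((hpath.density t ht).integrable_exp x₀),
        ← tilted_add_const μ (W t') (c t t')]
      congr 1
      ext x
      simp only [Pi.add_apply]
      ring
  refine ⟨fun t ht t' ht' => ⟨fun s hs => ⟨(hpath.density t ht).secant (hpath.density t' ht') x₀ hs,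
    ?_⟩, ?_⟩,
    (1 / 2) * (3 * (16 * M) + (4 + 16 * M) * (2 * (2 + M) / Real.exp (-(2 + M)) ^ 2)), fun t ht t' ht' => ?_⟩
  · have := hprob t ht
    have h := (hc t ht t' ht').integrable_abs_sub_tilted hs
    simp_rw [hsec t ht] at h
    simp_rw [hA, secantPair]
    exact h
  · have := hprob t ht
    have h := (hc t ht t' ht').intervalIntegrable_integral_abs_sub_tilted
    simp_rw [hsec t ht] at h
    simp_rw [hA, secantPair]
    exact h
  · have := hprob t ht
    have h := (hc t ht t' ht').abs_rejection_sub_barrier_le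
    simp_rw [hsec t ht, hend t ht] at h
    simp_rw [rejectionRate, secantBarrier, hA, secantPair]
    exact h
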